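/- \textbf{Setting.} Let $\mathcal X$ be a nonempty set, let $\mathcal S=\{[a,b] : -\infty<a<b<\infty\}$ be the family of nondegenerate closed bounded intervals of $\mathbb R$, and let $\mathcal H\subseteq\mathbb R^{\mathcal X}$ be nonempty. A (randomized) learner is a map $\mathcal A:(\mathcal X\times\mathcal S)^\star\times\mathcal X\to\Pi(\mathbb R)$, where $\Pi(\mathbb R)$ is the set of Borel probability measures on $\mathbb R$. On a stream $(x_1,S_1),\dots,(x_T,S_T)\in\mathcal X\times\mathcal S$ it draws, independently in each round $t$, a prediction $\mathcal A(x_t)$ from the measure assigned to the past examples $(x_1,S_1),\dots,(x_{t-1},S_{t-1})$ and the new instance $x_t$. Define $$\mathtt M_{\mathcal A}(T,\mathcal H)=\sup\ \mathbb E\Big[\sum_{t=1}^T\mathbf 1\{\mathcal A(x_t)\notin S_t\}\Big],$$ the supremum being over the streams of length $T$ for which some $h\in\mathcal H$ satisfies $h(x_t)\in S_t$ for all $t\le T$, and $$\mathtt R_{\mathcal A}(T,\mathcal H)=\sup\ \mathbb E\Big[\sum_{t=1}^T\mathbf 1\{\mathcal A(x_t)\notin S_t\}-\inf_{h\in\mathcal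 H}\sum_{t=1}^T\mathbf 1\{h(x_t)\notin S_t\}\Big],$$ the supremum being over all streams of length $T$. Let $\mathtt{SL}_2(\mathcal H)\in\{0,1,2,\dots\}\cup\{\infty\}$ be the supremum of the depths $d$ for which there are node labels $\mathcal T_t:\{1,2\}^{t-1}\to\mathcal X$ and edge labels $f_t:\{1,2\}^t\to\mathcal S$ ($1\le t\le d$) such that for every path $q\in\{1,2\}^d$ we have $f_t(q_{<t},1)\cap f_t(q_{<t},2)=\emptyset$ for all $t\le d$, and some $h_q\in\mathcal H$ satisfies $h_q(\mathcal T_t(q_{<t}))\in f_t(q_{\le t})$ for all $t\le d$. \textbf{Corollary (Online Interval Learnability).} For every integer $T\ge 1$, with the infima taken over all randomized learners, \begin{itemize} \item[(i)] $\displaystyle \frac{\min\{\mathtt{SL}_2(\mathcal H),T\}}{2}\ \le\ \inf_{\mathcal A}\mathtt M_{\mathcal A}(T,\mathcal H)\ \le\ \mathtt{SL}_2(\mathcal H)$; \item[(ii)] $\displaystyle \sqrt{\frac{\min\{\mathtt{SL}_2(\mathcal H),T\}\,T}{8}}\ \le\ \inf_{\mathcal A}\mathtt R_{\mathcal A}(T,\mathcal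 H)\ \le\ \mathtt{SL}_2(\mathcal H)+\sqrt{2\,\mathtt{SL}_2(\mathcal H)\,T\ln T}$. \end{itemize} If $\mathtt{SL}_2(\mathcal H)=\infty$, the two upper bounds are read as $\infty$. In particular, for $T\ge\mathtt{SL}_2(\mathcal H)$ the lower bounds are $\mathtt{SL}_2(\mathcal H)/2$ and $\sqrt{\mathtt{SL}_2(\mathcal H)\,T/8}$. -/

import Mathlib

open MeasureTheory
open scoped ENNReal

namespace SetFeedback

variable {X Y : Type*}

/-- A class `H` shatters a complete `X`-valued `[p]`-ary tree of depth `d`. The node reached by the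
path `(q₁, …, qₜ)` carries the instance `tree t (q₁, …, qₜ)`, for `t < d`, and the edge below it
that is indexed by `i` carries the set `f t (q₁, …, qₜ, i)` of the family `S`. -/
def Shatters (S : Set (Set Y)) (H : Set (X → Y)) (p d : ℕ)
    (tree : (t : Fin d) → (Fin (t : ℕ) → Fin p) → X)
    (f : (t : Fin d) → (Fin ((t : ℕ) + 1) → Fin p) → S) : Prop :=
  ∀ q : Fin d → Fin p,
    (∀ t : Fin d, ⋂ i : Fin p,
      (f t (Fin.snoc (α := fun _ => Fin p) (Fin.take (t : ℕ) t.isLt.le q) i) : Set Y) = ∅) ∧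
    ∃ h ∈ H, ∀ t : Fin d,
      h (tree t (Fin.take (t : ℕ) t.isLt.le q)) ∈ (f t (Fin.take ((t : ℕ) + 1) t.isLt q) : Set Y)

/-- The `p`-Set Littlestone dimension of `H` with respect to the family `S`: the largest depth of a
shattered `[p]`-ary tree, and `⊤` if there are shattered trees of arbitrarily large depth. -/
noncomputable def setLittlestoneDim (S : Set (Set Y)) (p : ℕ) (H : Set (X → Y)) : ℕ∞ :=
  ⨆ d ∈ {d : ℕ | ∃ tree f, Shatters S H p d tree f}, (d : ℕ∞)

/-- A randomized online learner: a map from the past labelled examples and the new instance to a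
probability measure on the label space. -/
abbrev Learner (X : Type*) {Y : Type*} [MeasurableSpace Y] (S : Set (Set Y)) :=
  List (X × S) → X → ProbabilityMeasure Y

/-- A stream of `T` labelled examples. -/
abbrev Stream (X : Type*) {Y : Type*} (S : Set (Set Y)) (T : ℕ) := Fin T → X × S

/-- The distribution from which the learner draws its prediction in round `t` of the stream `s`,
after having seen the examples of the rounds before `t`. -/
def prediction [MeasurableSpace Y] {S : Set (Set Y)} {T : ℕ} (A : Learner X S)
    (s : Stream X S T) (t : Fin T) : ProbabilityMeasure Y :=
  A ((List.ofFn s).take t) (s t).1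

/-- The joint law of the predictions on the stream `s`: each round has its own independent draw. -/
noncomputable def predictionLaw [MeasurableSpace Y] {S : Set (Set Y)} {T : ℕ} (A : Learner X S)
    (s : Stream X S T) : Measure (Fin T → Y) :=
  Measure.pi fun t => (prediction A s t : Measure Y)

/-- The cumulative loss `∑ₜ 1{yₜ ∉ Sₜ}` of the predictions `y` on the stream `s`. -/
noncomputable def cumulativeLoss {S : Set (Set Y)} {T : ℕ} (s : Stream X S T)
    (y : Fin T → Y) : ℝ :=
  ∑ t, ((s t).2 : Set Y)ᶜ.indicator (fun _ => (1 : ℝ)) (y t)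

/-- The stream `s` is realizable by `H`. -/
def Realizable {S : Set (Set Y)} {T : ℕ} (H : Set (X → Y)) (s : Stream X S T) : Prop :=
  ∃ h ∈ H, ∀ t, h (s t).1 ∈ ((s t).2 : Set Y)

/-- The worst-case expected number of mistakes of `A` over the realizable streams of length `T`. -/
noncomputable def mistakes [MeasurableSpace Y] {S : Set (Set Y)} (A : Learner X S) (T : ℕ)
    (H : Set (X → Y)) : EReal :=
  ⨆ s ∈ {s : Stream X S T | Realizable H s},
    ((∫ y, cumulativeLoss s y ∂predictionLaw A s : ℝ) : EReal)

/-- The worst-case expected regret of `A` against `H` over all streams of length `T`. -/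
noncomputable def regret [MeasurableSpace Y] {S : Set (Set Y)} (A : Learner X S) (T : ℕ)
    (H : Set (X → Y)) : EReal :=
  ⨆ s : Stream X S T,
    ((∫ y, (cumulativeLoss s y - ⨅ h : H, cumulativeLoss s fun t => h.1 (s t).1)
      ∂predictionLaw A s : ℝ) : EReal)

/-- The family of the closed bounded intervals `[a, b]` of the real line with `a < b`. -/
def closedIntervals : Set (Set ℝ) := {I | ∃ a b : ℝ, a < b ∧ I = Set.Icc a b}

end SetFeedback

/-! Upper bounds. Let V be the set of hypotheses still considered. If V shatters no tree of depth k
+ 1, then the intervals B for which {h ∈ V : h x ∈ B} still shatters depth k meet pairwise, since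
two disjoint ones would be the edges of a tree of depth k + 1. Helly's theorem on the line gives a
common point; predicting it, every error lowers the dimension (`exists_optimal_prediction`). In the
realizable case this allows at most d errors. In the agnostic case, fix a comparator h and update V
only in the rounds where h is right and the prediction wrong: there are at most d such rounds, so
this expert loses at most d more than h (`exists_expert`). Exponential weights over the at most (T +
1)^d sets of update rounds cost the square-root term (`expectedLoss_hedge_le`).

Lower bounds. The two edge sets at a node are disjoint, so every prediction misses one of them. An
adversary descending along the worse edge forces expected loss 1/2 per level. For regret, each of D
levels is repeated over a block of k rounds. With random edge labels the learner loses at least k/2,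
the better label only k/2 - E|W|/2, with W the simple random walk after k steps. The labels are
derandomized (`exists_block_walk`), the descent follows the majority label, and for block lengths
differing by at most one the gains add up to at least √(DT/8) (`sqrt_le_sum_walkAbs`). -/

namespace SetFeedback

/-! ### Recursive description of shattered binary trees -/

section Shattering

variable {X Y : Type*} {S : Set (Set Y)}

/-- The hypotheses of `H` that are correct on the labelled example `(x, B)`. -/
def restrict (H : Set (X → Y)) (x : X) (B : Set Y) : Set (X → Y) := {h ∈ H | h x ∈ B}

/-- Recursive form of shattering of a binary tree of depth `n`. -/
def ShattersRec (S : Set (Set Y)) : ℕ → Set (X → Y) → Prop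
  | 0, H => H.Nonempty
  | n + 1, H => ∃ (x : X) (B : Fin 2 → S), Disjoint (B 0 : Set Y) (B 1) ∧
      ∀ i, ShattersRec S n (restrict H x (B i))

lemma restrict_subset (H : Set (X → Y)) (x : X) (B : Set Y) : restrict H x B ⊆ H :=
  fun _ h => h.1

lemma restrict_mono {H K : Set (X → Y)} (h : H ⊆ K) (x : X) (B : Set Y) :
    restrict H x B ⊆ restrict K x B :=
  fun _ hg => ⟨h hg.1, hg.2⟩

lemma ShattersRec.mono {n : ℕ} {H K : Set (X → Y)} (h : ShattersRec S n H) (hHK : H ⊆ K) :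
    ShattersRec S n K := by
  induction n generalizing H K with
  | zero => exact Set.Nonempty.mono hHK h
  | succ n ih =>
    obtain ⟨x, B, hB, hr⟩ := h
    exact ⟨x, B, hB, fun i => ih (hr i) (restrict_mono hHK x _)⟩

lemma ShattersRec.pred {n : ℕ} {H : Set (X → Y)} (h : ShattersRec S (n + 1) H) :
    ShattersRec S n H := by
  induction n generalizing H with
  | zero =>
    obtain ⟨x, B, -, hr⟩ := h
    exact (hr 0).mono (restrict_subset _ _ _)
  | succ n ih =>
    obtain ⟨x, B, hB, hr⟩ := h
    exact ⟨x, B, hB, fun i => ih (hr i)⟩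

lemma ShattersRec.anti {m n : ℕ} {H : Set (X → Y)} (h : ShattersRec S n H) (hmn : m ≤ n) :
    ShattersRec S m H := by
  induction hmn with
  | refl => exact h
  | step _ ih => exact ih h.pred

lemma take_succ_cons {α : Type*} {n m : ℕ} (h : m ≤ n) (a : α) (q : Fin n → α) :
    Fin.take (α := fun _ => α) (m + 1) (Nat.succ_le_succ h) (Fin.cons a q : Fin (n + 1) → α) =
      (Fin.cons a (Fin.take m h q) : Fin (m + 1) → α) := by
  funext i
  refine Fin.cases ?_ (fun j => ?_) i <;> rfl

/-- The subtree below the root edge `i` is read off by prepending `i` to every path; the witness of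
such a path also satisfies the root constraint, hence lies in the restricted class. -/
lemma Shatters.shattersRec {n : ℕ} {H : Set (X → Y)}
    {tree : (t : Fin n) → (Fin (t : ℕ) → Fin 2) → X}
    {f : (t : Fin n) → (Fin ((t : ℕ) + 1) → Fin 2) → S} (h : Shatters S H 2 n tree f) :
    ShattersRec S n H := by
  induction n generalizing H with
  | zero =>
    obtain ⟨-, g, hg, -⟩ := h Fin.elim0
    exact ⟨g, hg⟩
  | succ n ih =>
    refine ⟨tree 0 Fin.elim0, fun i => f 0 (Fin.snoc (α := fun _ => Fin 2) Fin.elim0 i), ?_,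
      fun i => ?_⟩
    · have h0 : (⋂ i, (f 0 (Fin.snoc (α := fun _ => Fin 2) Fin.elim0 i) : Set Y)) = ∅ := by
        rw [← (h 0).1 0]
        refine Set.iInter_congr fun j => ?_
        congr 2
      rw [Set.disjoint_iff_inter_eq_empty, ← h0]
      ext y
      simp [Fin.forall_fin_two]
    · refine ih (tree := fun t w => tree t.succ (Fin.cons i w : Fin ((t : ℕ) + 1) → Fin 2))
        (f := fun t w => f t.succ (Fin.cons i w : Fin ((t : ℕ) + 1 + 1) → Fin 2)) fun q => ?_
      obtain ⟨h1, g, hg, h2⟩ := h (Fin.cons i q)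
      refine ⟨fun t => ?_, g, ⟨hg, ?_⟩, fun t => ?_⟩
      · have h3 := h1 t.succ
        rw [← h3]
        refine Set.iInter_congr fun j => ?_
        have e : (Fin.cons i (Fin.snoc (α := fun _ => Fin 2) (Fin.take (t : ℕ) t.isLt.le q) j) :
              Fin ((t : ℕ) + 1 + 1) → Fin 2) =
            Fin.snoc (α := fun _ => Fin 2)
              (Fin.take (α := fun _ => Fin 2) ((t : ℕ) + 1) (Nat.succ_le_succ t.isLt.le)
                (Fin.cons i q : Fin (n + 1) → Fin 2)) j := by
          rw [Fin.cons_snoc_eq_snoc_cons, ← take_succ_cons]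
        exact congrArg (fun w => (f t.succ w : Set Y)) e
      · have h3 := h2 0
        convert h3 using 3
        · funext j
          rw [Subsingleton.elim (α := Fin 1) j 0]
          rfl
        · congr 1
          exact funext fun j => Fin.elim0 j
      · have h3 := h2 t.succ
        have e1 := take_succ_cons (α := Fin 2) t.isLt.le i q
        have e2 := take_succ_cons (α := Fin 2) (m := t + 1) t.isLt i q
        change g (tree t.succ (Fin.cons i (Fin.take t t.isLt.le q) : Fin ((t : ℕ) + 1) → Fin 2)) ∈
          (f t.succ (Fin.cons i (Fin.take (t + 1) t.isLt q) : Fin ((t : ℕ) + 1 + 1) → Fin 2) :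
            Set Y)
        rw [← e1, ← e2]
        exact h3

lemma ShattersRec.exists_shatters {n : ℕ} {H : Set (X → Y)} (h : ShattersRec S n H) :
    ∃ tree f, Shatters S H 2 n tree f := by
  induction n generalizing H with
  | zero =>
    obtain ⟨g, hg⟩ := h
    exact ⟨fun t => t.elim0, fun t => t.elim0, fun q => ⟨fun t => t.elim0, g, hg, fun t => t.elim0⟩⟩
  | succ n ih =>
    obtain ⟨x, B, hB, hr⟩ := h
    choose tree f hf using fun i => ih (hr i)
    refine ⟨fun t => Fin.cases (motive := fun t => (Fin (t : ℕ) → Fin 2) → X) (fun _ => x)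
        (fun t (w : Fin ((t : ℕ) + 1) → Fin 2) => tree (w 0) t (Fin.tail w)) t,
      fun t => Fin.cases (motive := fun t => (Fin ((t : ℕ) + 1) → Fin 2) → S) (fun w => B (w 0))
        (fun t (w : Fin ((t : ℕ) + 1 + 1) → Fin 2) => f (w 0) t (Fin.tail w)) t, fun q => ?_⟩
    obtain ⟨h1, g, hg, h2⟩ := hf (q 0) (Fin.tail q)
    refine ⟨fun t => ?_, g, hg.1, fun t => ?_⟩
    · refine Fin.cases ?_ (fun t => ?_) t
      · rw [Set.disjoint_iff_inter_eq_empty] at hB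
        rw [← hB]
        ext y
        simp only [Set.mem_iInter, Fin.forall_fin_two]
        rfl
      · rw [← h1 t]
        refine Set.iInter_congr fun j => ?_
        have e : Fin.snoc (α := fun _ => Fin 2)
            (Fin.take ((t : ℕ) + 1) (Nat.succ_le_succ t.isLt.le) q) j =
            (Fin.cons (q 0) (Fin.snoc (α := fun _ => Fin 2)
              (Fin.take (t : ℕ) t.isLt.le (Fin.tail q)) j) : Fin ((t : ℕ) + 1 + 1) → Fin 2) := by
          rw [Fin.cons_snoc_eq_snoc_cons, ← take_succ_cons, Fin.cons_self_tail]
        have e' := congrArg (fun w : Fin ((t : ℕ) + 1 + 1) → Fin 2 =>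
          ((f (w 0) t (Fin.tail w) : S) : Set Y)) e
        simp only [Fin.cons_zero, Fin.tail_cons] at e'
        exact e'
    · refine Fin.cases ?_ (fun t => ?_) t
      · exact hg.2
      · exact h2 t

lemma le_setLittlestoneDim {n : ℕ} {H : Set (X → Y)} (h : ShattersRec S n H) :
    (n : ℕ∞) ≤ setLittlestoneDim S 2 H :=
  le_iSup₂_of_le n h.exists_shatters le_rfl

lemma shattersRec_of_le_setLittlestoneDim {n : ℕ} {H : Set (X → Y)} (hH : H.Nonempty)
    (h : (n : ℕ∞) ≤ setLittlestoneDim S 2 H) : ShattersRec S n H := by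
  rcases n with _ | n
  · exact hH
  -- A strict bound below a supremum yields a shattered tree of depth above `n`, even if the
  -- supremum is infinite.
  have h1 : ((n : ℕ) : ℕ∞) < setLittlestoneDim S 2 H :=
    lt_of_lt_of_le (by exact_mod_cast n.lt_succ_self) h
  obtain ⟨m, hm⟩ := lt_iSup_iff.1 h1
  obtain ⟨⟨tree, f, hs⟩, hm⟩ := lt_iSup_iff.1 hm
  exact hs.shattersRec.anti (by exact_mod_cast hm)

end Shattering

/-! ### Expected loss, computed round by round -/

section Loss

variable {X Y : Type*} {S : Set (Set Y)}

/-- The number of errors of the hypothesis `h` on the examples `c`. -/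
noncomputable def hypothesisLoss (h : X → Y) (c : List (X × S)) : ℝ :=
  (c.map fun e => (e.2 : Set Y)ᶜ.indicator (fun _ => (1 : ℝ)) (h e.1)).sum

lemma hypothesisLoss_append (h : X → Y) (c c' : List (X × S)) :
    hypothesisLoss h (c ++ c') = hypothesisLoss h c + hypothesisLoss h c' := by
  simp [hypothesisLoss]

lemma hypothesisLoss_nonneg (h : X → Y) (c : List (X × S)) : 0 ≤ hypothesisLoss h c :=
  List.sum_nonneg fun x hx => by
    obtain ⟨e, -, rfl⟩ := List.mem_map.1 hx
    exact Set.indicator_nonneg (fun _ _ => zero_le_one) _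

lemma cumulativeLoss_hypothesis {T : ℕ} (s : Stream X S T) (h : X → Y) :
    cumulativeLoss s (fun t => h (s t).1) = hypothesisLoss h (List.ofFn s) := by
  simp [cumulativeLoss, hypothesisLoss, List.map_ofFn, List.sum_ofFn]

variable [MeasurableSpace Y]

/-- The probability that the learner errs on the example `e` after the examples `L`. -/
noncomputable def roundLoss (A : Learner X S) (L : List (X × S)) (e : X × S) : ℝ :=
  (A L e.1 : Measure Y).real (e.2 : Set Y)ᶜ

/-- The expected number of errors of the learner on the examples `c` that follow the examples
`L`. -/
noncomputable def expectedLoss (A : Learner X S) : List (X × S) → List (X × S) → ℝ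
  | _, [] => 0
  | L, e :: c => roundLoss A L e + expectedLoss A (L ++ [e]) c

lemma roundLoss_nonneg (A : Learner X S) (L : List (X × S)) (e : X × S) : 0 ≤ roundLoss A L e :=
  measureReal_nonneg

lemma roundLoss_le_one (A : Learner X S) (L : List (X × S)) (e : X × S) : roundLoss A L e ≤ 1 :=
  measureReal_le_one

lemma expectedLoss_append (A : Learner X S) (L c c' : List (X × S)) :
    expectedLoss A L (c ++ c') = expectedLoss A L c + expectedLoss A (L ++ c) c' := by
  induction c generalizing L with
  | nil => simp [expectedLoss]
  | cons e c ih => simp [expectedLoss, ih, add_assoc]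

lemma expectedLoss_snoc (A : Learner X S) (c : List (X × S)) (e : X × S) :
    expectedLoss A [] (c ++ [e]) = expectedLoss A [] c + roundLoss A c e := by
  simp [expectedLoss_append, expectedLoss]

lemma expectedLoss_nonneg (A : Learner X S) (L c : List (X × S)) : 0 ≤ expectedLoss A L c := by
  induction c generalizing L with
  | nil => simp [expectedLoss]
  | cons e c ih => exact add_nonneg (roundLoss_nonneg A L e) (ih _)

lemma expectedLoss_le_length (A : Learner X S) (L c : List (X × S)) :
    expectedLoss A L c ≤ c.length := by
  induction c generalizing L with
  | nil => simp [expectedLoss]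
  | cons e c ih =>
    have := ih (L ++ [e])
    have := roundLoss_le_one A L e
    simp only [expectedLoss, List.length_cons, Nat.cast_add, Nat.cast_one]
    linarith

lemma sum_roundLoss (A : Learner X S) {T : ℕ} (s : Stream X S T) (L : List (X × S)) :
    ∑ t : Fin T, roundLoss A (L ++ (List.ofFn s).take t) (s t) =
      expectedLoss A L (List.ofFn s) := by
  induction T generalizing L with
  | zero => simp [expectedLoss]
  | succ T ih =>
    rw [Fin.sum_univ_succ, List.ofFn_succ, expectedLoss, ← ih (fun i => s i.succ) (L ++ [s 0])]
    simp

instance (A : Learner X S) {T : ℕ} (s : Stream X S T) :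
    IsProbabilityMeasure (predictionLaw A s) := by
  unfold predictionLaw
  infer_instance

lemma integrable_indicator_eval (hS : ∀ B ∈ S, MeasurableSet B) (A : Learner X S) {T : ℕ}
    (s : Stream X S T) (t : Fin T) :
    Integrable (fun y : Fin T → Y => ((s t).2 : Set Y)ᶜ.indicator (fun _ => (1 : ℝ)) (y t))
      (predictionLaw A s) :=
  Integrable.of_mem_Icc 0 1
    ((measurable_const.indicator (hS _ (s t).2.2).compl).comp (measurable_pi_apply t)).aemeasurable
    (.of_forall fun _ => ⟨Set.indicator_nonneg (fun _ _ => zero_le_one) _,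
      Set.indicator_le_self' (fun _ _ => zero_le_one) _⟩)

lemma integrable_cumulativeLoss (hS : ∀ B ∈ S, MeasurableSet B) (A : Learner X S) {T : ℕ}
    (s : Stream X S T) : Integrable (cumulativeLoss s) (predictionLaw A s) :=
  integrable_finsetSum _ fun t _ => integrable_indicator_eval hS A s t

lemma integral_cumulativeLoss (hS : ∀ B ∈ S, MeasurableSet B) (A : Learner X S) {T : ℕ}
    (s : Stream X S T) :
    ∫ y, cumulativeLoss s y ∂predictionLaw A s = expectedLoss A [] (List.ofFn s) := by
  unfold cumulativeLoss
  rw [integral_finsetSum _ fun t _ => integrable_indicator_eval hS A s t, ← sum_roundLoss A s []]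
  refine Finset.sum_congr rfl fun t _ => ?_
  have hm : MeasurableSet ((s t).2 : Set Y)ᶜ := (hS _ (s t).2.2).compl
  unfold predictionLaw
  rw [integral_comp_eval (μ := fun t => (prediction A s t : Measure Y))
    (f := ((s t).2 : Set Y)ᶜ.indicator (fun _ => (1 : ℝ)))
    (measurable_const.indicator hm).aestronglyMeasurable, integral_indicator_const _ hm]
  simp [roundLoss, prediction]

lemma integral_regret (hS : ∀ B ∈ S, MeasurableSet B) (A : Learner X S) {T : ℕ}
    (s : Stream X S T) (H : Set (X → Y)) :
    ∫ y, (cumulativeLoss s y - ⨅ h : H, cumulativeLoss s fun t => h.1 (s t).1)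
      ∂predictionLaw A s =
    expectedLoss A [] (List.ofFn s) - ⨅ h : H, hypothesisLoss h.1 (List.ofFn s) := by
  rw [integral_sub (integrable_cumulativeLoss hS A s) (integrable_const _),
    integral_cumulativeLoss hS]
  simp [cumulativeLoss_hypothesis]

lemma mistakes_le (hS : ∀ B ∈ S, MeasurableSet B) {A : Learner X S} {T : ℕ} {H : Set (X → Y)}
    {b : ℝ} (hb : ∀ c : List (X × S), ∀ h ∈ H, (∀ e ∈ c, h e.1 ∈ (e.2 : Set Y)) →
      expectedLoss A [] c ≤ b) : mistakes A T H ≤ (b : EReal) := by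
  refine iSup₂_le fun s hs => ?_
  obtain ⟨h, hh, hs⟩ := hs
  rw [integral_cumulativeLoss hS]
  refine EReal.coe_le_coe_iff.2 (hb _ h hh fun e he => ?_)
  obtain ⟨t, rfl⟩ := (List.mem_ofFn' _ _).1 he
  exact hs t

lemma le_mistakes (hS : ∀ B ∈ S, MeasurableSet B) {A : Learner X S} {T : ℕ} {H : Set (X → Y)}
    {b : ℝ} {c : List (X × S)} (hc : c.length = T) {h : X → Y} (hh : h ∈ H)
    (hcons : ∀ e ∈ c, h e.1 ∈ (e.2 : Set Y)) (hb : b ≤ expectedLoss A [] c) :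
    (b : EReal) ≤ mistakes A T H := by
  subst hc
  refine le_iSup₂_of_le c.get ⟨h, hh, fun t => hcons _ (c.get_mem t)⟩ ?_
  rw [integral_cumulativeLoss hS, List.ofFn_get]
  exact EReal.coe_le_coe_iff.2 hb

lemma regret_le (hS : ∀ B ∈ S, MeasurableSet B) {A : Learner X S} {T : ℕ} {H : Set (X → Y)}
    (hH : H.Nonempty) {b : ℝ} (hb : ∀ c : List (X × S), c.length = T → ∀ h ∈ H,
      expectedLoss A [] c ≤ hypothesisLoss h c + b) : regret A T H ≤ (b : EReal) := by
  refine iSup_le fun s => ?_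
  rw [integral_regret hS]
  have : Nonempty H := hH.to_subtype
  have h1 : expectedLoss A [] (List.ofFn s) - b ≤ ⨅ h : H, hypothesisLoss h.1 (List.ofFn s) :=
    le_ciInf fun h => by linarith [hb (List.ofFn s) (by simp) h.1 h.2]
  exact EReal.coe_le_coe_iff.2 (by linarith)

lemma le_regret (hS : ∀ B ∈ S, MeasurableSet B) {A : Learner X S} {T : ℕ} {H : Set (X → Y)}
    {b : ℝ} {c : List (X × S)} (hc : c.length = T) {h : X → Y} (hh : h ∈ H)
    (hb : hypothesisLoss h c + b ≤ expectedLoss A [] c) : (b : EReal) ≤ regret A T H := by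
  subst hc
  refine le_iSup_of_le c.get ?_
  rw [integral_regret hS, List.ofFn_get]
  have h1 : ⨅ h : H, hypothesisLoss h.1 c ≤ hypothesisLoss h c :=
    ciInf_le (f := fun h : H => hypothesisLoss h.1 c)
      ⟨0, by rintro _ ⟨g, rfl⟩; exact hypothesisLoss_nonneg _ _⟩ ⟨h, hh⟩
  exact EReal.coe_le_coe_iff.2 (by linarith)

end Loss

/-! ### Version spaces for a set of update rounds -/

section VersionSpace

variable {X Y : Type*} {S : Set (Set Y)}

/-- The hypotheses of `H` that are correct on the examples of `L` with index in `I`. -/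
def versionSpace (H : Set (X → Y)) (I : Set ℕ) (L : List (X × S)) : Set (X → Y) :=
  {h ∈ H | ∀ i ∈ I, ∀ e, L[i]? = some e → h e.1 ∈ (e.2 : Set Y)}

lemma versionSpace_nil (H : Set (X → Y)) (I : Set ℕ) :
    versionSpace H I ([] : List (X × S)) = H := by
  simp [versionSpace]

lemma versionSpace_congr {H : Set (X → Y)} {I J : Set ℕ} {L : List (X × S)}
    (h : ∀ i < L.length, i ∈ I ↔ i ∈ J) : versionSpace H I L = versionSpace H J L := by
  ext g
  refine and_congr_right fun _ => forall_congr' fun i => ?_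
  by_cases hi : i < L.length
  · rw [h i hi]
  · simp [List.getElem?_eq_none (not_lt.1 hi)]

lemma versionSpace_snoc_subset (H : Set (X → Y)) (I : Set ℕ) (L : List (X × S)) (e : X × S) :
    versionSpace H I (L ++ [e]) ⊆ versionSpace H I L := fun _ hg =>
  ⟨hg.1, fun i hi a ha => hg.2 i hi a (by
    rw [List.getElem?_append_left (List.getElem?_eq_some_iff.1 ha).1, ha])⟩

lemma versionSpace_snoc_subset_restrict {H : Set (X → Y)} {I : Set ℕ} {L : List (X × S)}
    (hI : L.length ∈ I) (e : X × S) :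
    versionSpace H I (L ++ [e]) ⊆ restrict (versionSpace H I L) e.1 e.2 := fun _ hg =>
  ⟨versionSpace_snoc_subset H I L e hg, hg.2 _ hI e (by simp)⟩

lemma mem_versionSpace_snoc {H : Set (X → Y)} {I : Set ℕ} {L : List (X × S)} {e : X × S}
    {h : X → Y} (h1 : h ∈ versionSpace H I L) (h2 : L.length ∈ I → h e.1 ∈ (e.2 : Set Y)) :
    h ∈ versionSpace H I (L ++ [e]) := by
  refine ⟨h1.1, fun i hi a ha => ?_⟩
  rcases lt_trichotomy i L.length with hlt | rfl | hgt
  · rw [List.getElem?_append_left hlt] at ha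
    exact h1.2 i hi a ha
  · simp only [List.getElem?_concat_length, Option.some.injEq] at ha
    exact ha ▸ h2 hi
  · rw [List.getElem?_eq_none (by simp; omega)] at ha
    cases ha

end VersionSpace

/-! ### The standard optimal algorithm and its experts -/

section Intervals

lemma closedIntervals_measurable : ∀ B ∈ closedIntervals, MeasurableSet B := by
  rintro _ ⟨a, b, -, rfl⟩
  exact measurableSet_Icc

/-- Helly's theorem on the line: pairwise intersecting closed bounded intervals have a common
point. -/
lemma exists_mem_of_pairwise_inter (F : Set closedIntervals)
    (hF : ∀ B ∈ F, ∀ C ∈ F, ((B : Set ℝ) ∩ C).Nonempty) : ∃ y : ℝ, ∀ B ∈ F, y ∈ (B : Set ℝ) := by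
  rcases F.eq_empty_or_nonempty with rfl | ⟨B₀, hB₀⟩
  · exact ⟨0, by simp⟩
  choose a b hab hI using fun B : closedIntervals => B.2
  have key : ∀ B ∈ F, ∀ C ∈ F, a B ≤ b C := fun B hB C hC => by
    obtain ⟨y, hy, hy'⟩ := hF B hB C hC
    rw [hI] at hy hy'
    exact hy.1.trans hy'.2
  refine ⟨sSup (a '' F), fun B hB => ?_⟩
  rw [hI B]
  exact ⟨le_csSup ⟨b B₀, by rintro _ ⟨C, hC, rfl⟩; exact key C hC _ hB₀⟩ ⟨B, hB, rfl⟩,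
    csSup_le ⟨_, B₀, hB₀, rfl⟩ (by rintro _ ⟨C, hC, rfl⟩; exact key C hC _ hB)⟩

variable {X : Type*}

/-- One point must serve all depths `k`. Only the least `k` with depth `k + 1` not shattered
matters: above it a restriction would shatter too much, below it the conclusion holds anyway. -/
lemma exists_optimal_prediction (V : Set (X → ℝ)) (x : X) :
    ∃ y : ℝ, ∀ k, ∀ B : closedIntervals, y ∉ (B : Set ℝ) →
      ShattersRec closedIntervals k (restrict V x B) → ShattersRec closedIntervals (k + 1) V := by
  classical
  by_cases hk : ∃ k, ¬ ShattersRec closedIntervals (k + 1) V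
  · obtain ⟨y, hy⟩ := exists_mem_of_pairwise_inter
      {B | ShattersRec closedIntervals (Nat.find hk) (restrict V x B)} fun B hB C hC => by
        by_contra hne
        refine Nat.find_spec hk ⟨x, ![B, C], ?_, Fin.forall_fin_two.2 ⟨hB, hC⟩⟩
        exact Set.disjoint_iff_inter_eq_empty.2 (Set.not_nonempty_iff_eq_empty.1 hne)
    refine ⟨y, fun k B hyB hB => by_contra fun hkV => ?_⟩
    rcases (Nat.find_min' hk hkV).eq_or_lt with h | h
    · exact hyB (hy B (h ▸ hB))
    · exact Nat.find_spec hk ((hB.mono (restrict_subset _ _ _)).anti h)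
  · push Not at hk
    exact ⟨0, fun k _ _ _ => hk k⟩

/-- The prediction of the standard optimal algorithm for the version space `V` at `x`. -/
noncomputable def optimalPrediction (V : Set (X → ℝ)) (x : X) : ℝ :=
  (exists_optimal_prediction V x).choose

lemma optimalPrediction_spec {V : Set (X → ℝ)} {x : X} {k : ℕ} {B : closedIntervals}
    (h : optimalPrediction V x ∉ (B : Set ℝ))
    (hk : ShattersRec closedIntervals k (restrict V x B)) :
    ShattersRec closedIntervals (k + 1) V :=
  (exists_optimal_prediction V x).choose_spec k B h hk

/-- The deterministic learner that runs the standard optimal algorithm and updates its version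
space in the rounds of `I` only. -/
noncomputable def expert (H : Set (X → ℝ)) (I : Set ℕ) : Learner X closedIntervals :=
  fun L x => ⟨Measure.dirac (optimalPrediction (versionSpace H I L) x), inferInstance⟩

lemma roundLoss_expert (H : Set (X → ℝ)) (I : Set ℕ) (L : List (X × closedIntervals))
    (e : X × closedIntervals) :
    roundLoss (expert H I) L e =
      (e.2 : Set ℝ)ᶜ.indicator (fun _ => 1) (optimalPrediction (versionSpace H I L) e.1) := by
  rw [roundLoss, expert, ProbabilityMeasure.coe_mk, measureReal_def, Measure.dirac_apply]
  by_cases h : optimalPrediction (versionSpace H I L) e.1 ∈ (e.2 : Set ℝ) <;> simp [h]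

lemma expectedLoss_expert_congr {H : Set (X → ℝ)} {I J : Set ℕ} {c : List (X × closedIntervals)}
    (h : ∀ i < c.length, i ∈ I ↔ i ∈ J) :
    expectedLoss (expert H I) [] c = expectedLoss (expert H J) [] c := by
  induction c using List.reverseRecOn with
  | nil => rw [expectedLoss, expectedLoss]
  | append_singleton c e ih =>
    have h' : ∀ i < c.length, i ∈ I ↔ i ∈ J := fun i hi => h i (by simp; omega)
    rw [expectedLoss_snoc, expectedLoss_snoc, ih h', roundLoss_expert, roundLoss_expert,
      versionSpace_congr h']

lemma expectedLoss_expert_univ_le {H : Set (X → ℝ)} {d : ℕ}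
    (hd : ∀ k, ShattersRec closedIntervals k H → k ≤ d) {c : List (X × closedIntervals)}
    {h : X → ℝ} (hh : h ∈ H) (hc : ∀ e ∈ c, h e.1 ∈ (e.2 : Set ℝ)) :
    expectedLoss (expert H Set.univ) [] c ≤ d := by
  -- Potential argument: the dimension of the version space plus the errors so far never exceeds
  -- `d`.
  have key : ∀ c : List (X × closedIntervals), ∀ k,
      ShattersRec closedIntervals k (versionSpace H Set.univ c) →
        k + expectedLoss (expert H Set.univ) [] c ≤ d := fun c => by
    induction c using List.reverseRecOn with
    | nil =>
      intro k hk
      rw [versionSpace_nil] at hk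
      simpa [expectedLoss] using hd k hk
    | append_singleton c e ih =>
      intro k hk
      rw [expectedLoss_snoc, roundLoss_expert]
      by_cases hy : optimalPrediction (versionSpace H Set.univ c) e.1 ∈ (e.2 : Set ℝ)
      · simpa [hy] using ih k (hk.mono (versionSpace_snoc_subset H _ c e))
      · have := ih (k + 1) (optimalPrediction_spec hy
          (hk.mono (versionSpace_snoc_subset_restrict (Set.mem_univ _) e)))
        push_cast at this
        simp only [Set.indicator_of_mem (Set.mem_compl hy)]
        linarith
  have h0 : h ∈ versionSpace H Set.univ c :=
    ⟨hh, fun i _ e he => hc e (List.mem_of_getElem? he)⟩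
  simpa using key c 0 ⟨h, h0⟩

/-- Some expert with few updates errs hardly more often than the hypothesis `h`. -/
lemma exists_expert {H : Set (X → ℝ)} {d : ℕ}
    (hd : ∀ k, ShattersRec closedIntervals k H → k ≤ d) {h : X → ℝ} (hh : h ∈ H)
    (c : List (X × closedIntervals)) :
    ∃ I : Finset ℕ, I.card ≤ d ∧
      expectedLoss (expert H I) [] c ≤ hypothesisLoss h c + d := by
  -- Invariant: `h` survives all updates, and each update has lowered the dimension by at least one,
  -- which caps their number by `d`.
  suffices key : ∃ I : Finset ℕ, (∀ i ∈ I, i < c.length) ∧ h ∈ versionSpace H I c ∧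
      (∀ k, ShattersRec closedIntervals k (versionSpace H I c) → k + I.card ≤ d) ∧
      expectedLoss (expert H I) [] c ≤ hypothesisLoss h c + I.card by
    obtain ⟨I, -, h1, h2, h3⟩ := key
    have h4 : I.card ≤ d := by simpa using h2 0 ⟨h, h1⟩
    exact ⟨I, h4, h3.trans (by gcongr)⟩
  induction c using List.reverseRecOn with
  | nil =>
    refine ⟨∅, by simp, ?_, fun k hk => ?_, by simp [expectedLoss, hypothesisLoss]⟩
    · rwa [versionSpace_nil]
    · rw [versionSpace_nil] at hk
      simpa using hd k hk
  | append_singleton c e ih =>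
    obtain ⟨I, hI, h1, h2, h3⟩ := ih
    have hnot : c.length ∉ I := fun hm => (hI _ hm).false
    by_cases hcase : h e.1 ∈ (e.2 : Set ℝ) ∧
        optimalPrediction (versionSpace H I c) e.1 ∉ (e.2 : Set ℝ)
    · have hcongr : ∀ i < c.length,
          i ∈ (I : Set ℕ) ↔ i ∈ ((insert c.length I : Finset ℕ) : Set ℕ) :=
        fun i hi => by simp [hi.ne]
      have hV := versionSpace_congr (H := H) (L := c) hcongr
      have hmem : c.length ∈ ((insert c.length I : Finset ℕ) : Set ℕ) := by simp
      refine ⟨insert c.length I, fun i hi => ?_, ?_, fun k hk => ?_, ?_⟩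
      · rw [List.length_append, List.length_singleton]
        rcases Finset.mem_insert.1 hi with rfl | hi
        · omega
        · have := hI i hi
          omega
      · exact mem_versionSpace_snoc (hV ▸ h1) fun _ => hcase.1
      · have h4 := hk.mono (versionSpace_snoc_subset_restrict hmem e)
        rw [← hV] at h4
        have := h2 _ (optimalPrediction_spec hcase.2 h4)
        rw [Finset.card_insert_of_notMem hnot]
        lia
      · rw [expectedLoss_snoc, ← expectedLoss_expert_congr hcongr, hypothesisLoss_append,
          Finset.card_insert_of_notMem hnot]
        have := roundLoss_le_one (expert H (insert c.length I : Finset ℕ)) c e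
        have := hypothesisLoss_nonneg h [e]
        rw [Nat.cast_add, Nat.cast_one]
        linarith
    -- Without an update, an error of the expert is also an error of `h`.
    · refine ⟨I, fun i hi => ?_, mem_versionSpace_snoc h1 fun hm => absurd hm hnot,
        fun k hk => h2 k (hk.mono (versionSpace_snoc_subset H _ c e)), ?_⟩
      · rw [List.length_append]
        exact (hI i hi).trans_le (Nat.le_add_right _ _)
      · rw [expectedLoss_snoc, hypothesisLoss_append, roundLoss_expert]
        have : (e.2 : Set ℝ)ᶜ.indicator (fun _ => (1 : ℝ))
            (optimalPrediction (versionSpace H I c) e.1) ≤ hypothesisLoss h [e] := by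
          by_cases h5 : h e.1 ∈ (e.2 : Set ℝ)
          · have h6 : optimalPrediction (versionSpace H I c) e.1 ∈ (e.2 : Set ℝ) := by
              by_contra h6
              exact hcase ⟨h5, h6⟩
            simp [hypothesisLoss, h5, h6]
          · have h7 : hypothesisLoss h [e] = 1 := by simp [hypothesisLoss, h5]
            rw [h7]
            exact Set.indicator_le_self' (fun _ _ => zero_le_one) _
        linarith

end Intervals

/-! ### Exponential weights -/

section Hedge

variable {X Y : Type*} [MeasurableSpace Y] {S : Set (Set Y)} {ι : Type*} [Fintype ι] [Nonempty ι]

/-- Hoeffding's lemma for a Bernoulli variable. -/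
lemma bernoulli_mgf_le {p : ℝ} (hp0 : 0 ≤ p) (hp1 : p ≤ 1) (η : ℝ) :
    1 - p + p * Real.exp (-η) ≤ Real.exp (-η * p + η ^ 2 / 8) := by
  set μ : Measure ℝ := ENNReal.ofReal (1 - p) • Measure.dirac 0 + ENNReal.ofReal p • Measure.dirac 1
    with hμ
  have hprob : IsProbabilityMeasure μ := ⟨by
    simp [hμ, ← ENNReal.ofReal_add (sub_nonneg.2 hp1) hp0]⟩
  have hint : ∀ f : ℝ → ℝ, ∫ x, f x ∂μ = (1 - p) * f 0 + p * f 1 := fun f => by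
    rw [hμ, integral_add_measure, integral_smul_measure, integral_smul_measure, integral_dirac,
      integral_dirac, ENNReal.toReal_ofReal (sub_nonneg.2 hp1), ENNReal.toReal_ofReal hp0,
      smul_eq_mul, smul_eq_mul]
    · exact (integrable_dirac (by simp)).smul_measure ENNReal.ofReal_ne_top
    · exact (integrable_dirac (by simp)).smul_measure ENNReal.ofReal_ne_top
  -- This bounds the variable centred at its mean `p`; the resulting factor `exp (η * p)` is moved
  -- across at the end.
  have hsub := ProbabilityTheory.hasSubgaussianMGF_of_mem_Icc (μ := μ) (X := fun x : ℝ => x)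
    (a := 0) (b := 1) aemeasurable_id (by
      rw [hμ, ae_add_measure_iff]
      refine ⟨Measure.ae_smul_measure ?_ _, Measure.ae_smul_measure ?_ _⟩ <;>
        simp)
  have h := hsub.mgf_le (-η)
  rw [ProbabilityTheory.mgf, hint, hint] at h
  have e0 : Real.exp (-η * (0 - ((1 - p) * 0 + p * 1))) = Real.exp (η * p) := by ring_nf
  have e1 : Real.exp (-η * (1 - ((1 - p) * 0 + p * 1))) = Real.exp (-η) * Real.exp (η * p) := by
    rw [← Real.exp_add]; ring_nf
  rw [e0, e1] at h
  have e2 : ((((‖(1 : ℝ) - 0‖₊ / 2) ^ 2 : NNReal) : ℝ) * (-η) ^ 2 / 2) = η ^ 2 / 8 := by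
    push_cast
    norm_num
    ring
  rw [e2] at h
  rw [Real.exp_add, neg_mul, Real.exp_neg (η * p), ← div_eq_inv_mul, le_div_iff₀ (Real.exp_pos _)]
  calc _ = _ := by ring
    _ ≤ _ := h

/-- The normalizing constant of the exponential weights. -/
noncomputable def hedgeTotal (η : ℝ) (A : ι → Learner X S) (L : List (X × S)) : ℝ :=
  ∑ i, Real.exp (-η * expectedLoss (A i) [] L)

/-- The exponential weights of the learners `A i` after the examples `L`. -/
noncomputable def hedgeWeight (η : ℝ) (A : ι → Learner X S) (L : List (X × S)) (i : ι) : ℝ :=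
  Real.exp (-η * expectedLoss (A i) [] L) / hedgeTotal η A L

lemma hedgeTotal_pos (η : ℝ) (A : ι → Learner X S) (L : List (X × S)) : 0 < hedgeTotal η A L :=
  Finset.sum_pos (fun _ _ => Real.exp_pos _) Finset.univ_nonempty

lemma hedgeWeight_nonneg (η : ℝ) (A : ι → Learner X S) (L : List (X × S)) (i : ι) :
    0 ≤ hedgeWeight η A L i :=
  div_nonneg (Real.exp_pos _).le (hedgeTotal_pos η A L).le

lemma sum_hedgeWeight (η : ℝ) (A : ι → Learner X S) (L : List (X × S)) :
    ∑ i, hedgeWeight η A L i = 1 := by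
  simp only [hedgeWeight]
  rw [← Finset.sum_div]
  exact div_self (hedgeTotal_pos η A L).ne'

/-- The exponential weights learner over the learners `A i`. -/
noncomputable def hedge (η : ℝ) (A : ι → Learner X S) : Learner X S := fun L x =>
  ⟨∑ i, ENNReal.ofReal (hedgeWeight η A L i) • (A i L x : Measure Y), ⟨by
    simp only [Measure.coe_finsetSum, Finset.sum_apply, Measure.smul_apply, measure_univ,
      smul_eq_mul, mul_one]
    rw [← ENNReal.ofReal_sum_of_nonneg fun i _ => hedgeWeight_nonneg η A L i, sum_hedgeWeight,
      ENNReal.ofReal_one]⟩⟩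

lemma roundLoss_hedge (η : ℝ) (A : ι → Learner X S) (L : List (X × S)) (e : X × S) :
    roundLoss (hedge η A) L e = ∑ i, hedgeWeight η A L i * roundLoss (A i) L e := by
  simp only [roundLoss, hedge, ProbabilityMeasure.coe_mk, measureReal_def, Measure.coe_finsetSum,
    Finset.sum_apply, Measure.smul_apply, smul_eq_mul]
  rw [ENNReal.toReal_sum fun i _ => ENNReal.mul_ne_top ENNReal.ofReal_ne_top (measure_ne_top _ _)]
  simp [ENNReal.toReal_mul, ENNReal.toReal_ofReal (hedgeWeight_nonneg η A L _)]

/-- Convexity of `exp` between 0 and `-η`. It makes fractional losses enter the total weight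
linearly, so that they average to the loss of the mixture. -/
lemma exp_neg_mul_le {p : ℝ} (hp0 : 0 ≤ p) (hp1 : p ≤ 1) (η : ℝ) :
    Real.exp (-η * p) ≤ 1 - p + p * Real.exp (-η) := by
  have h := convexOn_exp.2 (Set.mem_univ 0) (Set.mem_univ (-η)) (sub_nonneg.2 hp1) hp0 (by ring)
  simp only [smul_eq_mul, mul_zero, zero_add, Real.exp_zero, mul_one] at h
  rwa [mul_comm (-η) p]

/-- In each round the total weight shrinks at least by the Bernoulli factor of the mixture's loss,
which `bernoulli_mgf_le` bounds. -/
lemma hedgeTotal_le (η : ℝ) (A : ι → Learner X S) (c : List (X × S)) :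
    hedgeTotal η A c ≤ Fintype.card ι *
      Real.exp (-η * expectedLoss (hedge η A) [] c + c.length * (η ^ 2 / 8)) := by
  induction c using List.reverseRecOn with
  | nil => simp [hedgeTotal, expectedLoss]
  | append_singleton c e ih =>
    set p := roundLoss (hedge η A) c e with hp
    have hZ := hedgeTotal_pos η A c
    have hw : ∀ i, Real.exp (-η * expectedLoss (A i) [] c) =
        hedgeTotal η A c * hedgeWeight η A c i := fun i => by
      rw [hedgeWeight, mul_div_cancel₀ _ hZ.ne']
    have h1 : hedgeTotal η A (c ++ [e]) ≤
        hedgeTotal η A c * (1 - p + p * Real.exp (-η)) := by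
      have h2 : hedgeTotal η A (c ++ [e]) ≤ ∑ i, hedgeTotal η A c * (hedgeWeight η A c i *
          (1 - roundLoss (A i) c e + roundLoss (A i) c e * Real.exp (-η))) := by
        unfold hedgeTotal
        refine Finset.sum_le_sum fun i _ => ?_
        rw [expectedLoss_snoc, mul_add, Real.exp_add, ← hedgeTotal, ← mul_assoc, ← hw i]
        exact mul_le_mul_of_nonneg_left
          (exp_neg_mul_le (roundLoss_nonneg _ _ _) (roundLoss_le_one _ _ _) η) (Real.exp_pos _).le
      refine h2.trans_eq ?_
      rw [← Finset.mul_sum, hp, roundLoss_hedge]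
      congr 1
      calc _ = ∑ i, (hedgeWeight η A c i - hedgeWeight η A c i * roundLoss (A i) c e +
              hedgeWeight η A c i * roundLoss (A i) c e * Real.exp (-η)) :=
            Finset.sum_congr rfl fun i _ => by ring
        _ = _ := by
            rw [Finset.sum_add_distrib, Finset.sum_sub_distrib, sum_hedgeWeight, Finset.sum_mul]
    have h3 := bernoulli_mgf_le (roundLoss_nonneg (hedge η A) c e)
      (roundLoss_le_one (hedge η A) c e) η
    calc _ ≤ _ := h1
      _ ≤ _ := mul_le_mul ih h3 (le_trans (Real.exp_pos _).le (exp_neg_mul_le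
            (roundLoss_nonneg (hedge η A) c e) (roundLoss_le_one (hedge η A) c e) η))
            (by positivity)
      _ = _ := by
        rw [mul_assoc, ← Real.exp_add, expectedLoss_snoc]
        congr 2
        simp only [List.length_append, List.length_singleton]
        push_cast
        ring

lemma expectedLoss_hedge_le {η : ℝ} (hη : 0 < η) (A : ι → Learner X S) (c : List (X × S)) (i : ι) :
    expectedLoss (hedge η A) [] c ≤
      expectedLoss (A i) [] c + Real.log (Fintype.card ι) / η + c.length * η / 8 := by
  have h1 : Real.exp (-η * expectedLoss (A i) [] c) ≤ hedgeTotal η A c :=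
    Finset.single_le_sum (f := fun i => Real.exp (-η * expectedLoss (A i) [] c))
      (fun _ _ => (Real.exp_pos _).le) (Finset.mem_univ i)
  have hN : (0 : ℝ) < Fintype.card ι := by exact_mod_cast Fintype.card_pos
  have h2 := Real.log_le_log (Real.exp_pos _) (h1.trans (hedgeTotal_le η A c))
  rw [Real.log_exp, Real.log_mul hN.ne' (Real.exp_pos _).ne', Real.log_exp] at h2
  have h3 : η * expectedLoss (hedge η A) [] c ≤
      η * (expectedLoss (A i) [] c + Real.log (Fintype.card ι) / η + c.length * η / 8) := by
    rw [mul_add, mul_add, mul_div_cancel₀ _ hη.ne']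
    linarith
  exact le_of_mul_le_mul_left h3 hη

end Hedge

/-! ### Mean absolute value of the simple random walk -/

section Walk

/-- The expectation of `|c + W|` for the simple random walk `W` after `r` steps. -/
noncomputable def walkAbs : ℕ → ℤ → ℝ
  | 0, c => |(c : ℝ)|
  | r + 1, c => (walkAbs r (c + 1) + walkAbs r (c - 1)) / 2

/-- The probability of `c + W = 0` for the simple random walk `W` after `r` steps. -/
noncomputable def walkZero : ℕ → ℤ → ℝ
  | 0, c => if c = 0 then 1 else 0
  | r + 1, c => (walkZero r (c + 1) + walkZero r (c - 1)) / 2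

lemma walkZero_nonneg (r : ℕ) (c : ℤ) : 0 ≤ walkZero r c := by
  induction r generalizing c with
  | zero => unfold walkZero; split_ifs <;> norm_num
  | succ r ih => unfold walkZero; have := ih (c + 1); have := ih (c - 1); positivity

/-- Discrete Tanaka formula: averaging |c + 1| and |c - 1| gives |c|, plus 1 at the origin; the
linear recursion propagates this. -/
lemma walkAbs_succ (r : ℕ) (c : ℤ) : walkAbs (r + 1) c = walkAbs r c + walkZero r c := by
  induction r generalizing c with
  | zero =>
    simp only [walkAbs, walkZero]
    rcases lt_trichotomy c 0 with h | rfl | h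
    · have h1 : (c : ℝ) ≤ -1 := by exact_mod_cast Int.le_sub_one_of_lt h
      rw [if_neg h.ne]
      push_cast
      rw [abs_of_nonpos, abs_of_nonpos, abs_of_nonpos] <;> linarith
    · norm_num
    · have h1 : (1 : ℝ) ≤ c := by exact_mod_cast h
      rw [if_neg h.ne']
      push_cast
      rw [abs_of_nonneg, abs_of_nonneg, abs_of_nonneg] <;> linarith
  | succ r ih =>
    rw [walkAbs, ih, ih, walkAbs, walkZero]
    ring

lemma walkZero_of_lt {r : ℕ} {c : ℤ} (h : c < -r) : walkZero r c = 0 := by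
  induction r generalizing c with
  | zero => exact if_neg (by simpa using h.ne)
  | succ r ih =>
    push_cast at h
    rw [walkZero, ih (by linarith), ih (by linarith)]
    simp

/-- From this start, 0 is reached by exactly `k` downward steps; the induction is Pascal's rule. -/
lemma walkZero_eq_choose (r k : ℕ) : walkZero r (2 * k - r) = r.choose k / 2 ^ r := by
  induction r generalizing k with
  | zero => cases k <;> simp [walkZero]; omega
  | succ r ih =>
    rw [walkZero, show (2 * (k : ℤ) - (r + 1 : ℕ) + 1) = 2 * k - r by push_cast; ring, ih]
    rcases k with _ | k
    · rw [walkZero_of_lt (by push_cast; linarith)]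
      simp [pow_succ]
      ring
    · rw [show (2 * ((k + 1 : ℕ) : ℤ) - (r + 1 : ℕ) - 1) = 2 * k - r by push_cast; ring, ih,
        Nat.choose_succ_succ, pow_succ]
      push_cast
      ring

/-- The return probability of the simple random walk after `2 n` steps. -/
noncomputable def returnProb (n : ℕ) : ℝ := n.centralBinom / 4 ^ n

lemma returnProb_nonneg (n : ℕ) : 0 ≤ returnProb n := by
  unfold returnProb
  positivity

lemma walkZero_two_mul (n : ℕ) : walkZero (2 * n) 0 = returnProb n := by
  have := walkZero_eq_choose (2 * n) n
  rw [pow_mul] at this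
  norm_num at this
  rw [this, returnProb, Nat.centralBinom]

lemma returnProb_succ (n : ℕ) : (2 * n + 2) * returnProb (n + 1) = (2 * n + 1) * returnProb n := by
  have h : ((n : ℝ) + 1) * (n + 1).centralBinom = 2 * (2 * n + 1) * n.centralBinom := by
    exact_mod_cast n.succ_mul_centralBinom_succ
  unfold returnProb
  rw [pow_succ]
  field_simp
  linarith

lemma le_walkAbs_two_mul (n : ℕ) : 2 * n * returnProb n ≤ walkAbs (2 * n) 0 := by
  induction n with
  | zero => simp [walkAbs]
  | succ n ih =>
    rw [show 2 * (n + 1) = 2 * n + 1 + 1 by ring, walkAbs_succ, walkAbs_succ, walkZero_two_mul]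
    -- The return probability at odd times is dropped; only its sign is needed.
    have := walkZero_nonneg (2 * n + 1) 0
    have := returnProb_succ n
    push_cast
    linarith

lemma le_walkAbs_two_mul_add_one (n : ℕ) :
    (2 * n + 1) * returnProb n ≤ walkAbs (2 * n + 1) 0 := by
  rw [walkAbs_succ, walkZero_two_mul]
  linarith [le_walkAbs_two_mul n]

/-- The quantity `4 * n * returnProb n ^ 2` equals 1 at `n = 1` and is nondecreasing from there. -/
lemma one_le_four_mul_returnProb_sq (n : ℕ) :
    1 ≤ 4 * (n + 1 : ℝ) * returnProb (n + 1) ^ 2 := by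
  induction n with
  | zero => norm_num [returnProb, Nat.centralBinom]
  | succ n ih =>
    have h := returnProb_succ (n + 1)
    push_cast at h ⊢
    set x := returnProb (n + 1)
    have h' : returnProb (n + 1 + 1) = (2 * n + 3) * x / (2 * n + 4) := by
      rw [eq_div_iff (by positivity)]
      linarith
    rw [h', div_pow, mul_div_assoc', le_div_iff₀ (by positivity)]
    have h1 : (4 * ((n : ℝ) + 1)) * (n + 2) ≤ (2 * n + 3) ^ 2 := by nlinarith
    have h2 : 0 ≤ x ^ 2 := sq_nonneg x
    nlinarith [mul_le_mul_of_nonneg_right h1 (mul_nonneg (by positivity : (0 : ℝ) ≤ 4) h2)]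

/-- Bounding each block of length k by √(k/2) would not suffice: by Cauchy–Schwarz the sum of these
is at most the target. The two lengths are treated jointly, by the parity of `m`. -/
lemma sqrt_le_sum_walkAbs {m : ℕ} (hm : 1 ≤ m) (p q : ℕ) :
    √(((p + q : ℕ) : ℝ) * (p * m + q * (m + 1) : ℕ) / 2) ≤
      p * walkAbs m 0 + q * walkAbs (m + 1) 0 := by
  obtain ⟨n, rfl | rfl⟩ := m.even_or_odd'
  · obtain ⟨n, rfl⟩ : ∃ k, n = k + 1 := ⟨n - 1, by omega⟩
    have h1 := le_walkAbs_two_mul (n + 1)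
    have h2 := le_walkAbs_two_mul_add_one (n + 1)
    have h3 := one_le_four_mul_returnProb_sq n
    have h0 := returnProb_nonneg (n + 1)
    set x := returnProb (n + 1)
    set t : ℝ := ((p * (2 * (n + 1)) + q * (2 * (n + 1) + 1) : ℕ) : ℝ) with ht
    push_cast at h1 h2 ht ⊢
    calc _ ≤ t * x := by
          refine Real.sqrt_le_iff.2 ⟨by positivity, ?_⟩
          have h4 : (p + q : ℝ) ≤ 2 * t * x ^ 2 := by
            have h5 : (p + q : ℝ) * (2 * (n + 1)) ≤ t := by
              rw [ht]
              nlinarith [(Nat.cast_nonneg q : (0 : ℝ) ≤ q)]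
            have h6 := mul_le_mul_of_nonneg_right h5 (by positivity : 0 ≤ 2 * x ^ 2)
            have h7 := mul_le_mul_of_nonneg_left h3 (by positivity : (0 : ℝ) ≤ p + q)
            linarith
          have := mul_le_mul_of_nonneg_right h4 (by positivity : 0 ≤ t / 2)
          linarith
      _ = p * (2 * (n + 1) * x) + q * ((2 * (n + 1) + 1) * x) := by rw [ht]; ring
      _ ≤ _ := by gcongr
  · have h1 := le_walkAbs_two_mul_add_one n
    have h2 := le_walkAbs_two_mul (n + 1)
    have h3 := one_le_four_mul_returnProb_sq n
    have h0 := returnProb_nonneg (n + 1)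
    have h4 := returnProb_succ n
    -- Now lengths `2 * n + 1` and `2 * n + 2` have the same lower bound.
    rw [← h4] at h1
    set x := returnProb (n + 1)
    rw [show 2 * n + 1 + 1 = 2 * (n + 1) by ring]
    push_cast at h2 ⊢
    calc _ ≤ (p + q) * ((2 * n + 2) * x) := by
          refine Real.sqrt_le_iff.2 ⟨by positivity, ?_⟩
          have h5 : (p * (2 * n + 1) + q * (2 * (n + 1)) : ℝ) ≤ (p + q) * (2 * (n + 1)) := by
            nlinarith [(Nat.cast_nonneg p : (0 : ℝ) ≤ p)]
          have h6 := mul_le_mul_of_nonneg_left h5 (by positivity : (0 : ℝ) ≤ (p + q) / 2)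
          have h7 := mul_le_mul_of_nonneg_left h3
            (by positivity : (0 : ℝ) ≤ (p + q) ^ 2 * (n + 1))
          linarith
      _ = p * ((2 * n + 2) * x) + q * (2 * (n + 1) * x) := by ring
      _ ≤ _ := by gcongr

end Walk

/-! ### Adversaries descending a shattered tree -/

section Adversary

variable {X Y : Type*} [MeasurableSpace Y] {S : Set (Set Y)}

lemma one_le_roundLoss_add (A : Learner X S) (L : List (X × S)) (x : X) {B : Fin 2 → S}
    (hB : Disjoint (B 0 : Set Y) (B 1)) :
    1 ≤ roundLoss A L (x, B 0) + roundLoss A L (x, B 1) := by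
  have h := measureReal_union_le (μ := (A L x : Measure Y)) (B 0 : Set Y)ᶜ (B 1 : Set Y)ᶜ
  rw [← Set.compl_inter, Set.disjoint_iff_inter_eq_empty.1 hB, Set.compl_empty,
    probReal_univ] at h
  exact h

lemma exists_realizable_of_shattersRec (A : Learner X S) {n : ℕ} {V : Set (X → Y)}
    (hV : ShattersRec S n V) (L : List (X × S)) :
    ∃ c : List (X × S), c.length = n ∧ (n / 2 : ℝ) ≤ expectedLoss A L c ∧
      ∃ h ∈ V, ∀ e ∈ c, h e.1 ∈ (e.2 : Set Y) := by
  induction n generalizing V L with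
  | zero =>
    obtain ⟨h, hh⟩ := hV
    exact ⟨[], rfl, by simp [expectedLoss], h, hh, by simp⟩
  | succ n ih =>
    obtain ⟨x, B, hB, hr⟩ := hV
    obtain ⟨i, hi⟩ : ∃ i, 1 / 2 ≤ roundLoss A L (x, B i) := by
      by_contra! hlt
      linarith [one_le_roundLoss_add A L x hB, hlt 0, hlt 1]
    obtain ⟨c, hc, hloss, h, hh, hcons⟩ := ih (hr i) (L ++ [(x, B i)])
    refine ⟨(x, B i) :: c, by simp [hc], ?_, h, hh.1, ?_⟩
    · rw [expectedLoss]
      push_cast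
      linarith
    · exact List.forall_mem_cons.2 ⟨hh.2, hcons⟩

/-- Derandomization: `z` is the current lead of label 0, and `walkAbs` is the expected final |lead|
under fair coin flips. The average over the two labels meets the bound, so one label does. -/
lemma exists_block_walk (A : Learner X S) (x : X) {B : Fin 2 → S}
    (hB : Disjoint (B 0 : Set Y) (B 1)) (r : ℕ) (z : ℤ) (L : List (X × S)) :
    ∃ w : List (Fin 2), w.length = r ∧
      r + walkAbs r z ≤ 2 * expectedLoss A L (w.map fun i => (x, B i)) +
        |(z : ℝ) + w.count 0 - w.count 1| := by
  induction r generalizing z L with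
  | zero => exact ⟨[], rfl, by simp [expectedLoss, walkAbs]⟩
  | succ r ih =>
    have hL := one_le_roundLoss_add A L x hB
    have hW : walkAbs (r + 1) z = (walkAbs r (z + 1) + walkAbs r (z - 1)) / 2 := rfl
    rcases le_total (1 + walkAbs (r + 1) z) (2 * roundLoss A L (x, B 0) + walkAbs r (z + 1))
      with h | h
    · obtain ⟨w, hw, hloss⟩ := ih (z + 1) (L ++ [(x, B 0)])
      refine ⟨0 :: w, by simp [hw], ?_⟩
      rw [List.map_cons, expectedLoss, List.count_cons_self, List.count_cons_of_ne (by decide)]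
      push_cast at hloss ⊢
      rw [show (z : ℝ) + (w.count 0 + 1) - w.count 1 = z + 1 + w.count 0 - w.count 1 by ring]
      linarith
    · obtain ⟨w, hw, hloss⟩ := ih (z - 1) (L ++ [(x, B 1)])
      refine ⟨1 :: w, by simp [hw], ?_⟩
      rw [List.map_cons, expectedLoss, List.count_cons_self, List.count_cons_of_ne (by decide)]
      push_cast at hloss ⊢
      rw [show (z : ℝ) + w.count 0 - (w.count 1 + 1) = z - 1 + w.count 0 - w.count 1 by ring]
      linarith

omit [MeasurableSpace Y] in
lemma hypothesisLoss_block_le {h : X → Y} {x : X} {B : Fin 2 → S} {j : Fin 2}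
    (hj : h x ∈ (B j : Set Y)) (w : List (Fin 2)) :
    hypothesisLoss h (w.map fun i => (x, B i)) + w.count j ≤ w.length := by
  induction w with
  | nil => simp [hypothesisLoss]
  | cons i w ih =>
    have h1 : hypothesisLoss h ((i :: w).map fun i => (x, B i)) =
        (B i : Set Y)ᶜ.indicator (fun _ => (1 : ℝ)) (h x) +
          hypothesisLoss h (w.map fun i => (x, B i)) := by simp [hypothesisLoss]
    rw [h1, List.length_cons]
    push_cast
    by_cases hij : i = j
    · subst hij
      rw [List.count_cons_self, Set.indicator_of_notMem (by simpa using hj)]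
      push_cast
      linarith
    · rw [List.count_cons_of_ne hij]
      have : (B i : Set Y)ᶜ.indicator (fun _ => (1 : ℝ)) (h x) ≤ 1 :=
        Set.indicator_le_self' (fun _ _ => zero_le_one) _
      linarith

/-- The label `j` is the majority label of the block: it misses (r - |lead|) / 2 rounds. -/
lemma exists_block (A : Learner X S) (x : X) {B : Fin 2 → S}
    (hB : Disjoint (B 0 : Set Y) (B 1)) (r : ℕ) (L : List (X × S)) :
    ∃ c : List (X × S), c.length = r ∧ ∃ j, ∀ h : X → Y, h x ∈ (B j : Set Y) →
      hypothesisLoss h c + walkAbs r 0 / 2 ≤ expectedLoss A L c := by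
  obtain ⟨w, hw, hloss⟩ := exists_block_walk A x hB r 0 L
  have hcount : (w.count 0 : ℝ) + w.count 1 = r := by
    have : w.count 0 + w.count 1 = r := by
      rw [← hw]
      clear hloss hw
      induction w with
      | nil => rfl
      | cons i w ih => fin_cases i <;> simp <;> omega
    exact_mod_cast this
  refine ⟨w.map fun i => (x, B i), by simp [hw], ?_⟩
  rw [Int.cast_zero, zero_add] at hloss
  rcases le_total (w.count 1 : ℝ) (w.count 0) with hle | hle
  · refine ⟨0, fun h hx => ?_⟩
    have := hypothesisLoss_block_le hx w
    rw [hw] at this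
    rw [abs_of_nonneg (by linarith)] at hloss
    linarith
  · refine ⟨1, fun h hx => ?_⟩
    have := hypothesisLoss_block_le hx w
    rw [hw] at this
    rw [abs_of_nonpos (by linarith)] at hloss
    linarith

lemma exists_blocks (A : Learner X S) (ks : List ℕ) {V : Set (X → Y)}
    (hV : ShattersRec S ks.length V) (L : List (X × S)) :
    ∃ c : List (X × S), c.length = ks.sum ∧ ∃ h ∈ V,
      hypothesisLoss h c + (ks.map fun k => walkAbs k 0).sum / 2 ≤ expectedLoss A L c := by
  induction ks generalizing V L with
  | nil =>
    obtain ⟨h, hh⟩ := hV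
    exact ⟨[], rfl, h, hh, by simp [expectedLoss, hypothesisLoss]⟩
  | cons k ks ih =>
    obtain ⟨x, B, hB, hr⟩ := hV
    obtain ⟨c, hc, j, hj⟩ := exists_block A x hB k L
    obtain ⟨c', hc', h, hh, hloss⟩ := ih (hr j) (L ++ c)
    refine ⟨c ++ c', by simp [hc, hc'], h, hh.1, ?_⟩
    rw [expectedLoss_append, hypothesisLoss_append, List.map_cons, List.sum_cons]
    linarith [hj h hh.2]

lemma exists_balanced_blocks (A : Learner X S) {D T : ℕ} (hD : 1 ≤ D) (hDT : D ≤ T)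
    {V : Set (X → Y)} (hV : ShattersRec S D V) :
    ∃ c : List (X × S), c.length = T ∧ ∃ h ∈ V,
      hypothesisLoss h c + √(D * T / 8) ≤ expectedLoss A [] c := by
  have hm : 1 ≤ T / D := (Nat.one_le_div_iff hD).2 hDT
  have hq := Nat.mod_lt T hD
  set m := T / D with hm'
  -- Of the `D` blocks, `q` have length `m + 1` and the others length `m`.
  set q := T % D with hq'
  obtain ⟨p, hp⟩ : ∃ p, p + q = D := ⟨D - q, by omega⟩
  have hT : p * m + q * (m + 1) = T := by
    have := Nat.div_add_mod T D
    rw [← hm', ← hq', ← hp] at this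
    linarith
  obtain ⟨c, hc, h, hh, hloss⟩ := exists_blocks A (List.replicate p m ++ List.replicate q (m + 1))
    (by simpa [hp] using hV) []
  refine ⟨c, by simpa [hT] using hc, h, hh, le_trans ?_ hloss⟩
  have h1 := sqrt_le_sum_walkAbs hm p q
  rw [hp, hT] at h1
  have h2 : √((D : ℝ) * T / 8) = √((D : ℝ) * T / 2) / 2 := by
    rw [show (D : ℝ) * T / 8 = D * T / 2 / 2 ^ 2 by ring, Real.sqrt_div' _ (by positivity),
      Real.sqrt_sq (by norm_num)]
  simp only [List.map_append, List.map_replicate, List.sum_append, List.sum_replicate,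
    nsmul_eq_mul]
  linarith

end Adversary

/-! ### The four bounds -/

section Bounds

variable {X : Type*} {H : Set (X → ℝ)}

lemma exists_range_eq {d T : ℕ} {I : Finset ℕ} (hI : I.card ≤ d) :
    ∃ φ : Fin d → Fin (T + 1), ∀ i < T, i ∈ (I : Set ℕ) ↔ i ∈ Set.range fun j => (φ j : ℕ) := by
  -- The value `T` is no round of the stream; it pads sets with fewer than `d` elements.
  refine ⟨fun j => ⟨min (I.toList.getD j T) T, by omega⟩, fun i hi => ?_⟩
  simp only [Finset.mem_coe, Set.mem_range]
  constructor
  · intro h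
    obtain ⟨k, hk, rfl⟩ := List.getElem_of_mem (Finset.mem_toList.2 h)
    have hk' : k < I.card := by simpa using hk
    refine ⟨⟨k, hk'.trans_le hI⟩, ?_⟩
    simp only [List.getD_eq_getElem _ _ hk]
    omega
  · rintro ⟨j, hj⟩
    by_cases hk : (j : ℕ) < I.toList.length
    · rw [List.getD_eq_getElem _ _ hk] at hj
      have : I.toList[(j : ℕ)] = i := by omega
      rw [← this]
      exact Finset.mem_toList.1 (List.getElem_mem hk)
    · rw [List.getD_eq_default _ _ (not_lt.1 hk)] at hj
      omega

lemma exists_mistakes_le {d : ℕ} (hd : ∀ k, ShattersRec closedIntervals k H → k ≤ d) (T : ℕ) :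
    ∃ A : Learner X closedIntervals, mistakes A T H ≤ ((d : ℝ) : EReal) :=
  ⟨expert H Set.univ, mistakes_le closedIntervals_measurable fun _ _ hh hc =>
    expectedLoss_expert_univ_le hd hh hc⟩

lemma exists_expectedLoss_le {d T : ℕ} (hd : ∀ k, ShattersRec closedIntervals k H → k ≤ d)
    (hT : 1 ≤ T) :
    ∃ A : Learner X closedIntervals, ∀ c : List (X × closedIntervals), c.length = T → ∀ h ∈ H,
      expectedLoss A [] c ≤ hypothesisLoss h c + (d + √(2 * d * T * Real.log T)) := by
  rcases Nat.eq_zero_or_pos d with rfl | hd0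
  · refine ⟨expert H (∅ : Finset ℕ), fun c _ h hh => ?_⟩
    obtain ⟨I, hI, hloss⟩ := exists_expert hd hh c
    rw [Finset.card_eq_zero.1 (Nat.le_zero.1 hI)] at hloss
    simpa using hloss
  -- For `T = 1` the logarithm vanishes and gives no learning rate, but one round costs at most `1 ≤
  -- d`.
  rcases hT.eq_or_lt with rfl | hT
  · refine ⟨expert H ∅, fun c hc h _ => ?_⟩
    have h1 := expectedLoss_le_length (expert H ∅) [] c
    have h2 : (1 : ℝ) ≤ d := by exact_mod_cast hd0
    have h3 := hypothesisLoss_nonneg h c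
    rw [hc] at h1
    have h4 := Real.sqrt_nonneg (2 * d * (1 : ℕ) * Real.log (1 : ℕ))
    push_cast at h1 h4 ⊢
    linarith
  have hT2 : (2 : ℝ) ≤ T := by exact_mod_cast hT
  have hd1 : (0 : ℝ) < d := by exact_mod_cast hd0
  have hlog : 0 < Real.log T := Real.log_pos (by linarith)
  set B := 2 * d * Real.log T with hB
  have hB0 : 0 < B := by positivity
  set b := √B with hb
  set t := √(T : ℝ) with ht
  have hb0 : 0 < b := Real.sqrt_pos.2 hB0
  have ht0 : 0 < t := Real.sqrt_pos.2 (by linarith)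
  have hbt : √(2 * d * T * Real.log T) = b * t := by
    rw [hb, ht, ← Real.sqrt_mul hB0.le, hB]
    congr 1
    ring
  -- At this rate the two error terms are at most `b * t / 2` and `b * t / 4`, so the optimal rate
  -- is not needed.
  have hη : 0 < 2 * b / t := by positivity
  refine ⟨hedge (2 * b / t) fun φ : Fin d → Fin (T + 1) =>
    expert H (Set.range fun j => (φ j : ℕ)), fun c hc h hh => ?_⟩
  obtain ⟨I, hI, hloss⟩ := exists_expert hd hh c
  obtain ⟨φ, hφ⟩ := exists_range_eq (T := T) hI
  rw [expectedLoss_expert_congr fun i hi => hφ i (hc ▸ hi)] at hloss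
  have h1 := expectedLoss_hedge_le hη (fun φ : Fin d → Fin (T + 1) =>
    expert H (Set.range fun j => (φ j : ℕ))) c φ
  have hN : Real.log (Fintype.card (Fin d → Fin (T + 1))) ≤ b ^ 2 := by
    rw [Real.sq_sqrt hB0.le, hB]
    simp only [Fintype.card_fun, Fintype.card_fin]
    push_cast
    rw [Real.log_pow]
    -- T + 1 ≤ T² for T ≥ 2, whence the factor 2 in `B`.
    have h2 : Real.log (T + 1) ≤ Real.log (T ^ 2) :=
      Real.log_le_log (by linarith) (by nlinarith)
    rw [Real.log_pow] at h2
    push_cast at h2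
    nlinarith
  have h2 : Real.log (Fintype.card (Fin d → Fin (T + 1))) / (2 * b / t) ≤ b * t / 2 := by
    refine (div_le_div_of_nonneg_right hN hη.le).trans_eq ?_
    field_simp
  have h3 : (c.length : ℝ) * (2 * b / t) / 8 = b * t / 4 := by
    rw [hc, ← Real.sq_sqrt (by linarith : (0 : ℝ) ≤ T), ← ht]
    field_simp
    norm_num
  have h4 : 0 < b * t := by positivity
  rw [hbt]
  linarith

lemma exists_regret_le (hH : H.Nonempty) {d T : ℕ}
    (hd : ∀ k, ShattersRec closedIntervals k H → k ≤ d) (hT : 1 ≤ T) :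
    ∃ A : Learner X closedIntervals,
      regret A T H ≤ ((d + √(2 * d * T * Real.log T) : ℝ) : EReal) := by
  obtain ⟨A, hA⟩ := exists_expectedLoss_le hd hT
  exact ⟨A, regret_le closedIntervals_measurable hH hA⟩

lemma exists_consistent_example (x : X) (h : X → ℝ) :
    ∃ e : X × closedIntervals, h e.1 ∈ (e.2 : Set ℝ) :=
  ⟨(x, ⟨Set.Icc (h x) (h x + 1), h x, h x + 1, by simp, rfl⟩), by simp⟩

lemma half_le_mistakes [Nonempty X] {D T : ℕ} (hDT : D ≤ T)
    (hD : ShattersRec closedIntervals D H) (A : Learner X closedIntervals) :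
    ((D / 2 : ℝ) : EReal) ≤ mistakes A T H := by
  obtain ⟨c, hc, hloss, h, hh, hcons⟩ := exists_realizable_of_shattersRec A hD []
  -- Copies of an example consistent with `h` fill the stream up to length `T`.
  obtain ⟨e, he⟩ := exists_consistent_example (Classical.arbitrary X) h
  refine le_mistakes closedIntervals_measurable (c := c ++ List.replicate (T - D) e)
    (by simp [hc, hDT]) hh (fun a ha => ?_) ?_
  · rcases List.mem_append.1 ha with ha | ha
    · exact hcons a ha
    · rw [List.eq_of_mem_replicate ha]
      exact he
  · rw [expectedLoss_append]
    linarith [expectedLoss_nonneg A ([] ++ c) (List.replicate (T - D) e)]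

lemma sqrt_le_regret [Nonempty X] {D T : ℕ} (hDT : D ≤ T)
    (hD : ShattersRec closedIntervals D H) (A : Learner X closedIntervals) :
    ((√(D * T / 8) : ℝ) : EReal) ≤ regret A T H := by
  rcases Nat.eq_zero_or_pos D with rfl | hD0
  · obtain ⟨h, hh⟩ := hD
    obtain ⟨e, he⟩ := exists_consistent_example (Classical.arbitrary X) h
    refine le_regret closedIntervals_measurable (c := List.replicate T e) (by simp) hh ?_
    have := expectedLoss_nonneg A [] (List.replicate T e)
    simpa [hypothesisLoss, he] using this
  · obtain ⟨c, hc, h, hh, hloss⟩ := exists_balanced_blocks A hD0 hDT hD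
    exact le_regret closedIntervals_measurable hc hh hloss

end Bounds

lemma coe_ennreal_ofReal_of_nonneg {r : ℝ} (hr : 0 ≤ r) :
    ((ENNReal.ofReal r : ℝ≥0∞) : EReal) = r := by
  rw [EReal.coe_ennreal_ofReal, max_eq_left hr]

lemma ofReal_sqrt {r : ℝ} (hr : 0 ≤ r) : ENNReal.ofReal (√r) = ENNReal.ofReal r ^ (1 / 2 : ℝ) := by
  rw [Real.sqrt_eq_rpow, ENNReal.ofReal_rpow_of_nonneg hr (by norm_num)]

end SetFeedback

open SetFeedback in
theorem mainTheorem9 {X : Type*} [Nonempty X] (H : Set (X → ℝ)) (hH : H.Nonempty)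
    (T : ℕ) (hT : 1 ≤ T) (d : ℕ∞)
    (hd : d = SetFeedback.setLittlestoneDim SetFeedback.closedIntervals 2 H) :
    ((((min d T : ℕ∞) : ℝ≥0∞) / 2 : ℝ≥0∞) : EReal) ≤
        (⨅ A : SetFeedback.Learner X SetFeedback.closedIntervals, SetFeedback.mistakes A T H) ∧
    (⨅ A : SetFeedback.Learner X SetFeedback.closedIntervals, SetFeedback.mistakes A T H) ≤
        ((d : ℝ≥0∞) : EReal) ∧
    (((((min d T : ℕ∞) : ℝ≥0∞) * T / 8) ^ (1 / 2 : ℝ) : ℝ≥0∞) : EReal) ≤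
        (⨅ A : SetFeedback.Learner X SetFeedback.closedIntervals, SetFeedback.regret A T H) ∧
    (⨅ A : SetFeedback.Learner X SetFeedback.closedIntervals, SetFeedback.regret A T H) ≤
        (((d : ℝ≥0∞) + (2 * (d : ℝ≥0∞) * T * ENNReal.ofReal (Real.log T)) ^ (1 / 2 : ℝ) : ℝ≥0∞) :
          EReal) := by
  -- The depth used for the lower bounds is finite even when `d = ⊤`.
  obtain ⟨D, hD⟩ : ∃ D : ℕ, min d T = (D : ℕ∞) :=
    ⟨(min d T).toNat, (ENat.natCast_toNat (ne_top_of_le_ne_top (ENat.natCast_ne_top T)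
      (min_le_right d T))).symm⟩
  have hDT : D ≤ T := by
    have := hD ▸ min_le_right d (T : ℕ∞)
    exact_mod_cast this
  have hDH : ShattersRec closedIntervals D H :=
    shattersRec_of_le_setLittlestoneDim hH (hd ▸ hD ▸ min_le_left d (T : ℕ∞))
  have h1 : ((D : ℝ≥0∞) / 2) = ENNReal.ofReal (D / 2) := by
    rw [ENNReal.ofReal_div_of_pos (by norm_num)]
    simp
  have h2 : ((D : ℝ≥0∞) * T / 8) ^ (1 / 2 : ℝ) = ENNReal.ofReal (√(D * T / 8)) := by
    rw [ofReal_sqrt (by positivity), ENNReal.ofReal_div_of_pos (by norm_num),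
      ENNReal.ofReal_mul (by positivity)]
    simp
  refine ⟨?_, ?_, ?_, ?_⟩
  · rw [hD, ENat.toENNReal_coe, h1, coe_ennreal_ofReal_of_nonneg (by positivity)]
    exact le_iInf fun A => half_le_mistakes hDT hDH A
  · induction d using ENat.recTopCoe with
    | top => simp
    | coe d =>
      obtain ⟨A, hA⟩ := exists_mistakes_le (H := H) (d := d) (fun k hk => by
        exact_mod_cast hd ▸ le_setLittlestoneDim hk) T
      refine (iInf_le _ A).trans (hA.trans_eq ?_)
      rw [ENat.toENNReal_coe, ← ENNReal.ofReal_natCast,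
        coe_ennreal_ofReal_of_nonneg (Nat.cast_nonneg d)]
  · rw [hD, ENat.toENNReal_coe, h2, coe_ennreal_ofReal_of_nonneg (Real.sqrt_nonneg _)]
    exact le_iInf fun A => sqrt_le_regret hDT hDH A
  · induction d using ENat.recTopCoe with
    | top => simp
    | coe d =>
      obtain ⟨A, hA⟩ := exists_regret_le hH (d := d) (fun k hk => by
        exact_mod_cast hd ▸ le_setLittlestoneDim hk) hT
      refine (iInf_le _ A).trans (hA.trans_eq ?_)
      have hlog : 0 ≤ Real.log T := Real.log_natCast_nonneg T
      rw [← coe_ennreal_ofReal_of_nonneg (by positivity),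
        ENNReal.ofReal_add (by positivity) (Real.sqrt_nonneg _), ofReal_sqrt (by positivity),
        ENNReal.ofReal_mul (by positivity), ENNReal.ofReal_mul (by positivity),
        ENNReal.ofReal_mul (by positivity)]
      simp
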